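/- Let $n\ge 1$ be an integer; the following notions are used in dimensions $n$ and $n-1$ (there is no lattice-free set in $\mathbb{R}^0$, so for $n=1$ the result below is vacuous). A set $B\subseteq\mathbb{R}^n$ is called lattice-free if it is $n$-dimensional, closed and convex and its interior contains no point of $\mathbb{Z}^n$; a lattice-free set is maximal if it is not a proper subset of another lattice-free set. Let $\mathcal{L}_*^n$ be the family of all lattice-free polyhedra in $\mathbb{R}^n$, and, for an integer $i\ge 1$, let $\mathcal{L}_i^n$ be the family of all lattice-free polyhedra in $\mathbb{R}^n$ with at most $i$ facets. For nonempty $X\subseteq\mathbb{R}^n$ and $u\in\mathbb{R}^n$ put $w(X,u):=\sup_{x\in X}x\cdot u-\inf_{x\in X}x\cdot u\in[0,\infty]$, and let $e_n$ be the $n$-th standard basis vector. Let $L\in\mathcal{L}_*^n$, let $f\in\operatorname{int}(L)$, let $\gamma\in(0,1]$, and define $L':=\gamma(L-f)+f$. Assume that there are an integer $m\ge 1$, a number $t\in\mathbb{Z}$ and a maximal lattice-free set $D\in\mathcal{L}_m^{n-1}$ such that (a) $L\cap(\mathbb{R}^{n-1}\times\{t\})\subseteq D\times\{t\}$, (b)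 $w(L',e_n)\le 1$, and (c) $L'\cap(\mathbb{R}^{n-1}\times\{t\})$ is nonempty. Then there exists $B\in\mathcal{L}_{m+1}^n$ such that $\frac{1}{4}\gamma(L-f)+f\subseteq B$. -/

import Mathlib

/-! Lattice-free sets and lattice-free polyhedra in `ℝⁿ = (Fin n → ℝ)`.
Only the linear and the topological structure of `ℝⁿ` is used, never its norm. -/

namespace LatticeFree

open scoped Matrix

/-- `B` is an `n`-dimensional, closed, convex subset of `ℝⁿ`. -/
structure IsFullDimClosedConvex (n : ℕ) (B : Set (Fin n → ℝ)) : Prop where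
  convex : Convex ℝ B
  closed : IsClosed B
  full_dim : affineSpan ℝ B = ⊤

/-- `B` is a lattice-free set in `ℝⁿ`: an `n`-dimensional, closed, convex set whose interior
contains no point of `ℤⁿ`. -/
structure IsLatticeFree (n : ℕ) (B : Set (Fin n → ℝ)) : Prop where
  body : IsFullDimClosedConvex n B
  free : ∀ z : Fin n → ℤ, (fun i => (z i : ℝ)) ∉ interior B

/-- `B` is a maximal lattice-free set in `ℝⁿ`: it is lattice-free and not a proper subset of
another lattice-free set. -/
def IsMaximalLatticeFree (n : ℕ) (B : Set (Fin n → ℝ)) : Prop :=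
  Maximal (IsLatticeFree n) B

/-- `P` is a polyhedron: the solution set of finitely many linear inequalities. -/
def IsPolyhedron (n : ℕ) (P : Set (Fin n → ℝ)) : Prop :=
  ∃ (k : ℕ) (a : Fin k → Fin n → ℝ) (b : Fin k → ℝ), P = {x | ∀ i, a i ⬝ᵥ x ≤ b i}

/-- `F` is a facet of the polyhedron `P`: a nonempty (exposed) face of `P` whose dimension is
one less than the dimension of `P`. -/
structure IsFacet (n : ℕ) (P F : Set (Fin n → ℝ)) : Prop where
  nonempty : F.Nonempty
  exposed : IsExposed ℝ P F
  dim : Module.finrank ℝ (vectorSpan ℝ F) + 1 = Module.finrank ℝ (vectorSpan ℝ P)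

/-- The family of all lattice-free polyhedra in `ℝⁿ`. -/
def latticeFreePolyhedra (n : ℕ) : Set (Set (Fin n → ℝ)) :=
  {P | IsLatticeFree n P ∧ IsPolyhedron n P}

/-- The family of all lattice-free polyhedra in `ℝⁿ` with at most `i` facets. -/
def latticeFreePolyhedraLE (n i : ℕ) : Set (Set (Fin n → ℝ)) :=
  {P | P ∈ latticeFreePolyhedra n ∧ {F | IsFacet n P F}.encard ≤ i}

/-- The width `w(X, u) = sup_{x ∈ X} x ⬝ u - inf_{x ∈ X} x ⬝ u` of a nonempty set `X` in the
direction `u`, as an extended real. -/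
noncomputable def width {n : ℕ} (X : Set (Fin n → ℝ)) (u : Fin n → ℝ) : EReal :=
  (⨆ x ∈ X, ((x ⬝ᵥ u : ℝ) : EReal)) - ⨅ x ∈ X, ((x ⬝ᵥ u : ℝ) : EReal)

/-- The last standard basis vector of `ℝ^(d+1)`. -/
def lastBasisVector (d : ℕ) : Fin (d + 1) → ℝ :=
  Pi.single (Fin.last d) 1

/-- The set `D × {t}` in `ℝ^(d+1) = ℝ^d × ℝ`. -/
def atHeight {d : ℕ} (D : Set (Fin d → ℝ)) (t : ℝ) : Set (Fin (d + 1) → ℝ) :=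
  {x | Fin.init x ∈ D ∧ x (Fin.last d) = t}

/-- The homothetic copy `c (L - f) + f` of `L`. -/
def homothet {n : ℕ} (c : ℝ) (f : Fin n → ℝ) (L : Set (Fin n → ℝ)) : Set (Fin n → ℝ) :=
  (fun x => c • (x - f) + f) '' L

end LatticeFree

namespace LatticeFree

open scoped Matrix Topology

/-! Measure heights relative to `t`, and let `s` be the height of `f`. Heights on `L'` lie in `[-1,
1]`. If the quarter copy lies on one side of height `t`, a horizontal split contains it. Otherwise
`|s| ≤ 1/3`, and the quarter copy has heights in `[-1/4, 1/4]`.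

In that case each inequality of `D` tilts to a valid inequality `a i · x + c i * h ≤ b i` of `L`
(`exists_tilted_inequality`). Scaled to have slack 1 at `f`, it has slack at least `3/4` on the
quarter copy, so the slopes `c i` may still be lowered by up to 3. Tilted inequalities inside `|h| ≤
1` cut out a lattice-free set, because interior lattice points would have height `t` and lie in the
interior of `D`. One of the bounds `h ≤ 1`, `h ≥ -1` may be added as the extra facet; the other must
follow from the tilted inequalities. A convex combination with `∑ w i • a i = 0` bounds `h` alone,
and a theorem of the alternative supplies either weights making the slope at least `3/2`, or a way
to lower the slopes to make it at most `-3/2` (`exists_superset_of_slack`). -/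

/-! ### Linear inequalities and their solution sets -/

/-- A point interior to a set satisfies every valid nontrivial linear inequality strictly. -/
lemma dotProduct_lt_of_mem_interior {n : ℕ} {P : Set (Fin n → ℝ)} {a : Fin n → ℝ} {b : ℝ}
    (ha : a ≠ 0) (hP : ∀ x ∈ P, a ⬝ᵥ x ≤ b) {x : Fin n → ℝ} (hx : x ∈ interior P) :
    a ⬝ᵥ x < b := by
  have hcont : Filter.Tendsto (fun ε : ℝ => x + ε • a) (𝓝[>] 0) (𝓝 x) := by
    have : Filter.Tendsto (fun ε : ℝ => x + ε • a) (𝓝 0) (𝓝 (x + (0 : ℝ) • a)) :=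
      (by fun_prop : Continuous fun ε : ℝ => x + ε • a).tendsto 0
    rw [zero_smul, add_zero] at this
    exact this.mono_left nhdsWithin_le_nhds
  have h1 := hcont.eventually (mem_interior_iff_mem_nhds.1 hx)
  obtain ⟨ε, hε, hεpos⟩ := (h1.and self_mem_nhdsWithin).exists
  have h2 := hP _ hε
  have h3 : 0 < a ⬝ᵥ a := by
    have h4 : 0 ≤ a ⬝ᵥ a := Finset.sum_nonneg fun i _ => mul_self_nonneg (a i)
    exact lt_of_le_of_ne h4 fun h => ha (dotProduct_self_eq_zero.1 h.symm)
  rw [dotProduct_add, dotProduct_smul, smul_eq_mul] at h2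
  have h5 : 0 < ε * (a ⬝ᵥ a) := mul_pos hεpos h3
  linarith

lemma continuous_dotProduct_right {n : ℕ} (a : Fin n → ℝ) :
    Continuous fun x : Fin n → ℝ => a ⬝ᵥ x := by
  unfold dotProduct
  fun_prop

/-- The linear functional `x ↦ a ⬝ x`. -/
noncomputable def dotCLM {n : ℕ} (a : Fin n → ℝ) : (Fin n → ℝ) →L[ℝ] ℝ :=
  ⟨{ toFun := fun x => a ⬝ᵥ x
     map_add' := fun x y => dotProduct_add a x y
     map_smul' := fun c x => by simp [dotProduct_smul] }, continuous_dotProduct_right a⟩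

@[simp] lemma dotCLM_apply {n : ℕ} (a x : Fin n → ℝ) : dotCLM a x = a ⬝ᵥ x := rfl

lemma finrank_ker_dotCLM {n : ℕ} {a : Fin n → ℝ} (ha : a ≠ 0) :
    Module.finrank ℝ (LinearMap.ker (dotCLM a).toLinearMap) + 1 = n := by
  have h := Module.Dual.finrank_ker_add_one_of_ne_zero (f := (dotCLM a).toLinearMap)
    (by
      intro h
      have := LinearMap.congr_fun h a
      exact ha (dotProduct_self_eq_zero.1 (by simpa using this)))
  rw [h]
  simp

lemma isClosed_setOf_dotProduct_le {n k : ℕ} (a : Fin k → Fin n → ℝ) (b : Fin k → ℝ) :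
    IsClosed {x : Fin n → ℝ | ∀ i, a i ⬝ᵥ x ≤ b i} := by
  rw [Set.ofPred_forall]
  exact isClosed_iInter fun i => isClosed_le (continuous_dotProduct_right _) continuous_const

lemma convex_setOf_dotProduct_le {n k : ℕ} (a : Fin k → Fin n → ℝ) (b : Fin k → ℝ) :
    Convex ℝ {x : Fin n → ℝ | ∀ i, a i ⬝ᵥ x ≤ b i} := by
  rw [Set.ofPred_forall]
  exact convex_iInter fun i => convex_halfSpace_le (dotCLM (a i)).toLinearMap.isLinear _

lemma mem_interior_of_forall_dotProduct_lt {n k : ℕ} {a : Fin k → Fin n → ℝ} {b : Fin k → ℝ}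
    {x : Fin n → ℝ} (hx : ∀ i, a i ⬝ᵥ x < b i) :
    x ∈ interior {x : Fin n → ℝ | ∀ i, a i ⬝ᵥ x ≤ b i} := by
  have ho : IsOpen {x : Fin n → ℝ | ∀ i, a i ⬝ᵥ x < b i} := by
    rw [Set.ofPred_forall]
    exact isOpen_iInter_of_finite fun i =>
      isOpen_lt (continuous_dotProduct_right _) continuous_const
  exact interior_maximal (fun y hy i => (hy i).le) ho hx

lemma finrank_vectorSpan_of_affineSpan_eq_top {n : ℕ} {P : Set (Fin n → ℝ)}
    (hP : affineSpan ℝ P = ⊤) : Module.finrank ℝ (vectorSpan ℝ P) = n := by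
  rw [← direction_affineSpan, hP, AffineSubspace.direction_top, finrank_top]
  simp

/-! ### Facets versus irredundant inequalities -/

/-- Every facet of a full-dimensional polyhedron is cut out by one of its inequalities. -/
lemma IsFacet.exists_eq {n k : ℕ} {a : Fin k → Fin n → ℝ} {b : Fin k → ℝ}
    (ha : ∀ i, a i ≠ 0) {P F : Set (Fin n → ℝ)} (hP : P = {x | ∀ i, a i ⬝ᵥ x ≤ b i})
    (hspan : affineSpan ℝ P = ⊤) (hF : IsFacet n P F) :
    ∃ i, F = {x | x ∈ P ∧ a i ⬝ᵥ x = b i} := by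
  have hdim := finrank_vectorSpan_of_affineSpan_eq_top hspan
  obtain ⟨l, hl⟩ := hF.exposed hF.nonempty
  have hFP : F ⊆ P := hF.exposed.subset
  have hFconv : Convex ℝ F := hF.exposed.convex (hP ▸ convex_setOf_dotProduct_le a b)
  have hfd := hF.dim
  rw [hdim] at hfd
  -- Otherwise averaging points of `F`, one strict for each inequality, gives an interior point of
  -- `P` in `F`. The exposing functional is maximal there, hence zero, so `F = P` has the wrong
  -- dimension.
  have key : ∃ i, ∀ x ∈ F, a i ⬝ᵥ x = b i := by
    by_contra! hcon
    choose y hyF hy using hcon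
    have hyle : ∀ i j, a i ⬝ᵥ y j ≤ b i := fun i j => (hP.subset (hFP (hyF j))) i
    have hint : ∃ x ∈ F, x ∈ interior P := by
      rcases Nat.eq_zero_or_pos k with hk | hk
      · subst hk
        obtain ⟨x, hx⟩ := hF.nonempty
        refine ⟨x, hx, ?_⟩
        rw [hP]
        exact mem_interior_of_forall_dotProduct_lt fun i => i.elim0
      · have hk' : (0 : ℝ) < k := by exact_mod_cast hk
        refine ⟨∑ j, (1 / k : ℝ) • y j, hFconv.sum_mem (fun _ _ => by positivity)
          (by simp [hk'.ne']) fun j _ => hyF j, ?_⟩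
        rw [hP]
        refine mem_interior_of_forall_dotProduct_lt fun i => ?_
        rw [dotProduct_sum]
        have : b i = ∑ _j : Fin k, (1 / k : ℝ) * b i := by
          simp [hk'.ne']
        rw [this]
        refine Finset.sum_lt_sum (fun j _ => ?_) ⟨i, Finset.mem_univ _, ?_⟩
        · rw [dotProduct_smul, smul_eq_mul]
          exact mul_le_mul_of_nonneg_left (hyle i j) (by positivity)
        · rw [dotProduct_smul, smul_eq_mul]
          exact mul_lt_mul_of_pos_left (lt_of_le_of_ne (hyle i i) (hy i)) (by positivity)
    obtain ⟨x, hxF, hxP⟩ := hint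
    have hl0 : ∀ v, l v = 0 := by
      have hmax : IsLocalMax l x := by
        filter_upwards [mem_interior_iff_mem_nhds.1 hxP] with z hz
        rw [hl] at hxF
        exact hxF.2 z hz
      have := hmax.hasFDerivAt_eq_zero l.hasFDerivAt
      intro v
      rw [this]; rfl
    have hFeq : F = P := by
      rw [hl]; ext z; simp [hl0]
    rw [hFeq, hdim] at hfd
    omega
  obtain ⟨i, hi⟩ := key
  refine ⟨i, Set.Subset.antisymm (fun x hx => ⟨hFP hx, hi x hx⟩) fun x hx => ?_⟩
  obtain ⟨x₀, hx₀⟩ := hF.nonempty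
  have hle : vectorSpan ℝ F ≤ LinearMap.ker (dotCLM (a i)).toLinearMap := by
    rw [vectorSpan_def, Submodule.span_le]
    rintro _ ⟨u, hu, v, hv, rfl⟩
    simp [dotProduct_sub, hi u hu, hi v hv]
  -- Equal dimensions make `l` constant on the whole section of `P` by the hyperplane, so `F` is all
  -- of it.
  have heq : vectorSpan ℝ F = LinearMap.ker (dotCLM (a i)).toLinearMap := by
    refine Submodule.eq_of_le_of_finrank_eq hle ?_
    have := finrank_ker_dotCLM (ha i)
    omega
  have hle2 : vectorSpan ℝ F ≤ LinearMap.ker l.toLinearMap := by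
    rw [vectorSpan_def, Submodule.span_le]
    rintro _ ⟨u, hu, v, hv, rfl⟩
    rw [hl] at hu hv
    have h1 := hu.2 v hv.1
    have h2 := hv.2 u hu.1
    simp only [vsub_eq_sub, SetLike.mem_coe, LinearMap.mem_ker, ContinuousLinearMap.coe_coe,
      map_sub]
    linarith
  have hmem : x - x₀ ∈ vectorSpan ℝ F := by
    rw [heq]
    simp [dotProduct_sub, hi x₀ hx₀, hx.2]
  have hlx : l x = l x₀ := by
    have := hle2 hmem
    simp only [LinearMap.mem_ker, ContinuousLinearMap.coe_coe, map_sub] at this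
    linarith
  rw [hl] at hx₀ ⊢
  exact ⟨hx.1, fun y hy => hlx ▸ hx₀.2 y hy⟩

lemma encard_facets_le {n k : ℕ} {a : Fin k → Fin n → ℝ} {b : Fin k → ℝ}
    (ha : ∀ i, a i ≠ 0) {P : Set (Fin n → ℝ)} (hP : P = {x | ∀ i, a i ⬝ᵥ x ≤ b i})
    (hspan : affineSpan ℝ P = ⊤) : {F | IsFacet n P F}.encard ≤ k := by
  have hsub : {F | IsFacet n P F} ⊆ Set.range fun i => {x | x ∈ P ∧ a i ⬝ᵥ x = b i} := by
    intro F hF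
    obtain ⟨i, hi⟩ := IsFacet.exists_eq ha hP hspan hF
    exact ⟨i, hi.symm⟩
  refine (Set.encard_le_encard hsub).trans ?_
  rw [← Set.image_univ]
  refine (Set.encard_image_le _ _).trans ?_
  simp

/-- An inequality that is violated at a point satisfying all the others defines a facet, and no
other inequality defines the same facet. -/
lemma isFacet_of_irredundant {n k : ℕ} {a : Fin k → Fin n → ℝ} {b : Fin k → ℝ}
    (ha : ∀ i, a i ≠ 0) {P : Set (Fin n → ℝ)} (hP : P = {x | ∀ i, a i ⬝ᵥ x ≤ b i})
    (hspan : affineSpan ℝ P = ⊤) {i : Fin k} {y : Fin n → ℝ} (hy : b i < a i ⬝ᵥ y)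
    (hy' : ∀ j, j ≠ i → a j ⬝ᵥ y ≤ b j) :
    IsFacet n P {x | x ∈ P ∧ a i ⬝ᵥ x = b i} ∧
      ∃ z ∈ P, a i ⬝ᵥ z = b i ∧ ∀ j, j ≠ i → a j ⬝ᵥ z < b j := by
  have hconv : Convex ℝ P := hP ▸ convex_setOf_dotProduct_le a b
  obtain ⟨x₀, hx₀⟩ := hconv.interior_nonempty_iff_affineSpan_eq_top.2 hspan
  have hlt : ∀ j, a j ⬝ᵥ x₀ < b j := fun j =>
    dotProduct_lt_of_mem_interior (ha j) (fun x hx => (hP.subset hx) j) hx₀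
  have hz : ∃ z ∈ P, a i ⬝ᵥ z = b i ∧ ∀ j, j ≠ i → a j ⬝ᵥ z < b j := by
    -- The segment from the interior point `x₀` to `y` crosses hyperplane `i` at parameter `r`.
    set r := (b i - a i ⬝ᵥ x₀) / (a i ⬝ᵥ y - a i ⬝ᵥ x₀) with hr
    have hi := hlt i
    have hden : 0 < a i ⬝ᵥ y - a i ⬝ᵥ x₀ := by linarith
    have hr0 : 0 < r := div_pos (by linarith) hden
    have hr1 : r < 1 := (div_lt_one hden).2 (by linarith)
    have hval : ∀ j, a j ⬝ᵥ (x₀ + r • (y - x₀)) = (1 - r) * (a j ⬝ᵥ x₀) + r * (a j ⬝ᵥ y) := by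
      intro j
      rw [dotProduct_add, dotProduct_smul, dotProduct_sub, smul_eq_mul]
      ring
    have h1 : a i ⬝ᵥ (x₀ + r • (y - x₀)) = b i := by
      have : r * (a i ⬝ᵥ y - a i ⬝ᵥ x₀) = b i - a i ⬝ᵥ x₀ := div_mul_cancel₀ _ hden.ne'
      rw [hval]
      linarith
    have h2 : ∀ j, j ≠ i → a j ⬝ᵥ (x₀ + r • (y - x₀)) < b j := by
      intro j hj
      rw [hval]
      nlinarith [hlt j, hy' j hj]
    refine ⟨x₀ + r • (y - x₀), ?_, h1, h2⟩
    rw [hP]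
    intro j
    by_cases hj : j = i
    · rw [hj]; exact h1.le
    · exact (h2 j hj).le
  refine ⟨?_, hz⟩
  obtain ⟨z, hzP, hzi, hzj⟩ := hz
  have hle : ∀ x ∈ P, a i ⬝ᵥ x ≤ b i := fun x hx => (hP.subset hx) i
  refine ⟨⟨z, hzP, hzi⟩, fun _ => ⟨dotCLM (a i), ?_⟩, ?_⟩
  · ext x
    constructor
    · rintro ⟨hxP, hx⟩
      exact ⟨hxP, fun w hw => by simpa [hx] using hle w hw⟩
    · rintro ⟨hxP, hx⟩
      have := hx z hzP
      simp only [dotCLM_apply] at this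
      exact ⟨hxP, le_antisymm (hle x hxP) (by linarith)⟩
  · rw [finrank_vectorSpan_of_affineSpan_eq_top hspan]
    have : vectorSpan ℝ {x | x ∈ P ∧ a i ⬝ᵥ x = b i} =
        LinearMap.ker (dotCLM (a i)).toLinearMap := by
      apply le_antisymm
      · rw [vectorSpan_def, Submodule.span_le]
        rintro _ ⟨u, hu, v, hv, rfl⟩
        simp [dotProduct_sub, hu.2, hv.2]
      · intro v hv
        have hv0 : a i ⬝ᵥ v = 0 := by simpa using hv
        -- The other inequalities are strict at `z`, so short moves inside the hyperplane stay in
        -- `P`.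
        have hev : ∀ᶠ ε in 𝓝[>] (0 : ℝ), ∀ j, j ≠ i → a j ⬝ᵥ (z + ε • v) < b j := by
          rw [Filter.eventually_all]
          intro j
          by_cases hj : j = i
          · exact Filter.Eventually.of_forall fun _ h => absurd hj h
          have hc : Continuous fun ε : ℝ => a j ⬝ᵥ (z + ε • v) :=
            (continuous_dotProduct_right _).comp (by fun_prop)
          have h0 : a j ⬝ᵥ (z + (0 : ℝ) • v) < b j := by simpa using hzj j hj
          exact ((hc.tendsto 0).eventually_lt_const h0).filter_mono nhdsWithin_le_nhds
            |>.mono fun _ h _ => h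
        obtain ⟨ε, hε, hε0⟩ := (hev.and self_mem_nhdsWithin).exists
        have hε0 : 0 < ε := hε0
        have hw : a i ⬝ᵥ (z + ε • v) = b i := by
          rw [dotProduct_add, dotProduct_smul, hv0, hzi]; simp
        have hwP : z + ε • v ∈ P := by
          rw [hP]
          intro j
          by_cases hj : j = i
          · rw [hj]; exact hw.le
          · exact (hε j hj).le
        have hmem := vsub_mem_vectorSpan ℝ (s := {x | x ∈ P ∧ a i ⬝ᵥ x = b i})
          ⟨hwP, hw⟩ ⟨hzP, hzi⟩
        have : v = ε⁻¹ • ((z + ε • v) -ᵥ z) := by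
          rw [vsub_eq_sub, add_sub_cancel_left, smul_smul, inv_mul_cancel₀ hε0.ne', one_smul]
        rw [this]
        exact Submodule.smul_mem _ _ hmem
    rw [this]
    exact finrank_ker_dotCLM (ha i)

/-- A full-dimensional polyhedron is described by at most as many nontrivial inequalities as it
has facets. -/
lemma IsPolyhedron.exists_of_encard_facets_le {n m : ℕ} {P : Set (Fin n → ℝ)}
    (hpoly : IsPolyhedron n P) (hspan : affineSpan ℝ P = ⊤)
    (hm : {F | IsFacet n P F}.encard ≤ m) :
    ∃ (k : ℕ) (a : Fin k → Fin n → ℝ) (b : Fin k → ℝ), k ≤ m ∧ (∀ i, a i ≠ 0) ∧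
      P = {x | ∀ i, a i ⬝ᵥ x ≤ b i} := by
  classical
  have hne : P.Nonempty := by
    rw [← affineSpan_nonempty ℝ, hspan]
    exact ⟨0, trivial⟩
  -- In a description of minimal length no inequality can be dropped.
  obtain ⟨k, hk, hmin⟩ : ∃ k, (∃ (a : Fin k → Fin n → ℝ) (b : Fin k → ℝ),
      P = {x | ∀ i, a i ⬝ᵥ x ≤ b i}) ∧ ∀ k' < k, ¬ ∃ (a : Fin k' → Fin n → ℝ) (b : Fin k' → ℝ),
      P = {x | ∀ i, a i ⬝ᵥ x ≤ b i} :=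
    ⟨Nat.find hpoly, Nat.find_spec hpoly, fun _ h => Nat.find_min hpoly h⟩
  obtain ⟨a, b, hP⟩ := hk
  have hirr : ∀ i, ∃ y, b i < a i ⬝ᵥ y ∧ ∀ j, j ≠ i → a j ⬝ᵥ y ≤ b j := by
    intro i
    by_contra! hcon
    obtain ⟨k', rfl⟩ : ∃ k', k = k' + 1 := ⟨k - 1, by have := i.2; omega⟩
    refine hmin k' (Nat.lt_succ_self _) ⟨fun j => a (i.succAbove j), fun j => b (i.succAbove j), ?_⟩
    rw [hP]
    ext x
    refine ⟨fun h j => h _, fun h j => ?_⟩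
    rcases Fin.eq_self_or_eq_succAbove i j with rfl | ⟨j', rfl⟩
    · by_contra hlt
      obtain ⟨j', hj', hjlt⟩ := hcon x (not_le.1 hlt)
      obtain ⟨l, rfl⟩ := Fin.exists_succAbove_eq hj'
      exact absurd (h l) (not_le.2 hjlt)
    · exact h j'
  have ha : ∀ i, a i ≠ 0 := by
    intro i h0
    obtain ⟨y, hy, -⟩ := hirr i
    obtain ⟨x, hx⟩ := hne
    have := (hP.subset hx) i
    rw [h0, zero_dotProduct] at this hy
    linarith
  refine ⟨k, a, b, ?_, ha, hP⟩
  have hinj : Function.Injective fun i => {x | x ∈ P ∧ a i ⬝ᵥ x = b i} := by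
    intro i j hij
    by_contra hne
    obtain ⟨y, hy, hy'⟩ := hirr i
    obtain ⟨-, z, hz, hzi, hzj⟩ := isFacet_of_irredundant ha hP hspan hy hy'
    have : z ∈ {x | x ∈ P ∧ a j ⬝ᵥ x = b j} := by
      have h : z ∈ {x | x ∈ P ∧ a i ⬝ᵥ x = b i} := ⟨hz, hzi⟩
      exact Eq.subset hij h
    exact (hzj j (Ne.symm hne)).ne this.2
  have hsub : Set.range (fun i => {x | x ∈ P ∧ a i ⬝ᵥ x = b i}) ⊆ {F | IsFacet n P F} := by
    rintro _ ⟨i, rfl⟩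
    obtain ⟨y, hy, hy'⟩ := hirr i
    exact (isFacet_of_irredundant ha hP hspan hy hy').1
  have h1 := (Set.encard_le_encard hsub).trans hm
  rw [← Set.image_univ, hinj.encard_image] at h1
  simpa using h1

/-! ### Alternatives and tilting -/

/-- A theorem of the alternative for finitely many vectors. -/
lemma exists_dotProduct_gt_or_exists_stdSimplex {d k : ℕ} (a : Fin k → Fin d → ℝ)
    (c : Fin k → ℝ) :
    (∃ p : Fin d → ℝ, ∀ i, c i < a i ⬝ᵥ p) ∨
      ∃ w ∈ stdSimplex ℝ (Fin k), ∑ i, w i • a i = 0 ∧ 0 ≤ ∑ i, w i * c i := by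
  by_contra! hcon
  obtain ⟨hp, hw⟩ := hcon
  let T : (Fin k → ℝ) →ₗ[ℝ] (Fin d → ℝ) × ℝ :=
    (Fintype.linearCombination ℝ a).prod (Fintype.linearCombination ℝ c)
  have hT : ∀ w, T w = (∑ i, w i • a i, ∑ i, w i * c i) := fun w => by
    simp [T, Fintype.linearCombination_apply]
  have hcomp : IsCompact (T '' stdSimplex ℝ (Fin k)) :=
    (isCompact_stdSimplex ℝ (Fin k)).image T.continuous_of_finiteDimensional
  have hconv : Convex ℝ (T '' stdSimplex ℝ (Fin k)) :=
    (convex_stdSimplex ℝ (Fin k)).linear_image T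
  -- If the second alternative fails, the compact image of the simplex misses the ray `{0} × [0, ∞)`
  -- and can be strictly separated from it.
  have hdisj : Disjoint (T '' stdSimplex ℝ (Fin k))
      (({0} : Set (Fin d → ℝ)) ×ˢ Set.Ici (0 : ℝ)) := by
    rw [Set.disjoint_left]
    rintro _ ⟨w, hw1, rfl⟩ h
    rw [hT] at h
    exact absurd h.2 (not_le.2 (hw w hw1 h.1))
  obtain ⟨g, u, v, hgu, huv, hgv⟩ := geometric_hahn_banach_compact_closed hconv hcomp
    ((convex_singleton _).prod (convex_Ici _)) (isClosed_singleton.prod isClosed_Ici) hdisj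
  set q := g (0, 1) with hq
  let p : Fin d → ℝ := fun j => g (Pi.single j 1, 0)
  have hg : ∀ (x : Fin d → ℝ) (r : ℝ), g (x, r) = x ⬝ᵥ p + r * q := by
    intro x r
    have h1 : ((x, r) : (Fin d → ℝ) × ℝ) = (x, 0) + r • ((0 : Fin d → ℝ), (1 : ℝ)) := by simp
    have h2 : g (x, 0) = x ⬝ᵥ p := by
      have := LinearMap.pi_apply_eq_sum_univ
        (g.toLinearMap.comp (LinearMap.inl ℝ (Fin d → ℝ) ℝ)) x
      simp only [LinearMap.comp_apply, LinearMap.inl_apply, ContinuousLinearMap.coe_coe] at this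
      rw [this]
      refine Finset.sum_congr rfl fun j _ => ?_
      rw [smul_eq_mul]
      congr 3
      ext l
      simp [Pi.single_apply, eq_comm]
    rw [h1, map_add, map_smul, h2, smul_eq_mul]
  have hv0 : v < 0 := by simpa [hg] using hgv (0, 0) ⟨rfl, Set.self_mem_Ici⟩
  have hq0 : 0 ≤ q := by
    by_contra! hneg
    have hmem : ((0 : Fin d → ℝ), v / q) ∈ ({0} : Set (Fin d → ℝ)) ×ˢ Set.Ici (0 : ℝ) :=
      ⟨rfl, (div_nonneg_of_nonpos hv0.le hneg.le)⟩
    have := hgv _ hmem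
    rw [hg, div_mul_cancel₀ _ hneg.ne] at this
    simp at this
  have hlt : ∀ i, a i ⬝ᵥ p + c i * q < 0 := by
    intro i
    have := hgu _ ⟨Pi.single i 1, single_mem_stdSimplex ℝ i, rfl⟩
    rw [hT, hg] at this
    simp [Pi.single_apply] at this
    linarith
  -- If `q = 0`, every `a i ⬝ᵥ p` is negative and a large multiple of `-p` works; if `q > 0`, `-p /
  -- q` does.
  rcases hq0.eq_or_lt with h | h
  · obtain ⟨N, hN⟩ : ∃ N : ℝ, ∀ i, c i / (-(a i ⬝ᵥ p)) < N := by
      obtain ⟨N, hN⟩ := (Set.finite_range fun i => c i / (-(a i ⬝ᵥ p))).bddAbove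
      exact ⟨N + 1, fun i => (hN ⟨i, rfl⟩).trans_lt (lt_add_one N)⟩
    obtain ⟨i, hi⟩ := hp (-N • p)
    have h1 := hlt i
    rw [← h, mul_zero, add_zero] at h1
    have h2 := (div_lt_iff₀ (by linarith)).1 (hN i)
    rw [dotProduct_smul, smul_eq_mul] at hi
    linarith
  · obtain ⟨i, hi⟩ := hp (-q⁻¹ • p)
    have h1 := hlt i
    rw [dotProduct_smul, smul_eq_mul] at hi
    have h2 := mul_le_mul_of_nonneg_right hi h.le
    have h3 : -q⁻¹ * (a i ⬝ᵥ p) * q = -(a i ⬝ᵥ p) := by field_simp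
    linarith


/-- An inequality that is valid on a section of a convex set having points on both sides of the
section can be tilted to one that is valid on the whole set. -/
lemma exists_tilted_inequality {E : Type*} [AddCommGroup E] [Module ℝ E] {L : Set E}
    (hL : Convex ℝ L) (g h : E →ₗ[ℝ] ℝ) {b t : ℝ} (hg : ∀ x ∈ L, h x = t → g x ≤ b)
    (hpos : ∃ x ∈ L, t < h x) (hneg : ∃ x ∈ L, h x < t) :
    ∃ c : ℝ, ∀ x ∈ L, g x + c * (h x - t) ≤ b := by
  -- A segment from above to below meets the section; convexity there says that each lower bound for
  -- `c` is at most each upper bound.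
  have key : ∀ x ∈ L, t < h x → ∀ y ∈ L, h y < t →
      (g y - b) / (t - h y) ≤ (b - g x) / (h x - t) := by
    intro x hx hxt y hy hyt
    have hp : 0 < h x - t := by linarith
    have hq : 0 < t - h y := by linarith
    have hpq : 0 < h x - h y := by linarith
    have hmem : ((t - h y) / (h x - h y)) • x + ((h x - t) / (h x - h y)) • y ∈ L :=
      hL hx hy (by positivity) (by positivity) (by field_simp; ring)
    have h1 := hg _ hmem (by
      simp only [map_add, map_smul, smul_eq_mul]
      field_simp
      ring)
    simp only [map_add, map_smul, smul_eq_mul] at h1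
    rw [div_mul_eq_mul_div, div_mul_eq_mul_div, ← add_div, div_le_iff₀ hpq] at h1
    rw [div_le_div_iff₀ hq hp]
    linarith
  set S := (fun x => (b - g x) / (h x - t)) '' {x | x ∈ L ∧ t < h x} with hS
  obtain ⟨x₀, hx₀, hx₀t⟩ := hpos
  obtain ⟨y₀, hy₀, hy₀t⟩ := hneg
  have hSne : S.Nonempty := ⟨_, x₀, ⟨hx₀, hx₀t⟩, rfl⟩
  have hSb : BddBelow S := by
    refine ⟨(g y₀ - b) / (t - h y₀), ?_⟩
    rintro _ ⟨x, ⟨hx, hxt⟩, rfl⟩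
    exact key x hx hxt y₀ hy₀ hy₀t
  refine ⟨sInf S, fun x hx => ?_⟩
  rcases lt_trichotomy (h x) t with hlt | heq | hgt
  · have h1 : (g x - b) / (t - h x) ≤ sInf S := by
      refine le_csInf hSne ?_
      rintro _ ⟨y, ⟨hy, hyt⟩, rfl⟩
      exact key y hy hyt x hx hlt
    rw [div_le_iff₀ (by linarith)] at h1
    linarith
  · rw [heq, sub_self, mul_zero, add_zero]
    exact hg x hx heq
  · have h1 : sInf S ≤ (b - g x) / (h x - t) := csInf_le hSb ⟨x, ⟨hx, hgt⟩, rfl⟩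
    rw [le_div_iff₀ (by linarith)] at h1
    linarith

/-! ### Lattice-free polyhedra near a fixed height -/

lemma snoc_dotProduct {d : ℕ} (a : Fin d → ℝ) (e : ℝ) (x : Fin (d + 1) → ℝ) :
    (Fin.snoc a e : Fin (d + 1) → ℝ) ⬝ᵥ x = a ⬝ᵥ Fin.init x + e * x (Fin.last d) := by
  simp [dotProduct, Fin.sum_univ_castSucc, Fin.init]

lemma snoc_ne_zero_left {d : ℕ} {a : Fin d → ℝ} (ha : a ≠ 0) (e : ℝ) :
    (Fin.snoc a e : Fin (d + 1) → ℝ) ≠ 0 := by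
  intro h
  refine ha (funext fun j => ?_)
  simpa using congrFun h j.castSucc

lemma snoc_ne_zero_right {d : ℕ} (a : Fin d → ℝ) {e : ℝ} (he : e ≠ 0) :
    (Fin.snoc a e : Fin (d + 1) → ℝ) ≠ 0 := by
  intro h
  exact he (by simpa using congrFun h (Fin.last d))

/-- A point in the interior of a horizontal slab lies strictly between its bounds. -/
lemma last_mem_Ioo_of_mem_interior {d : ℕ} {B : Set (Fin (d + 1) → ℝ)} {l u : ℝ}
    (hB : ∀ x ∈ B, l ≤ x (Fin.last d) ∧ x (Fin.last d) ≤ u) {x : Fin (d + 1) → ℝ}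
    (hx : x ∈ interior B) : l < x (Fin.last d) ∧ x (Fin.last d) < u := by
  have h1 := dotProduct_lt_of_mem_interior (a := Fin.snoc (0 : Fin d → ℝ) 1) (b := u)
    (snoc_ne_zero_right _ one_ne_zero)
    (fun y hy => by simpa [snoc_dotProduct] using (hB y hy).2) hx
  have h2 := dotProduct_lt_of_mem_interior (a := Fin.snoc (0 : Fin d → ℝ) (-1)) (b := -l)
    (snoc_ne_zero_right _ (by norm_num))
    (fun y hy => by simpa [snoc_dotProduct] using (hB y hy).1) hx
  simp only [snoc_dotProduct, zero_dotProduct, zero_add, one_mul, neg_mul] at h1 h2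
  exact ⟨by linarith, h1⟩

lemma mem_latticeFreePolyhedraLE_of_eq {n k m : ℕ} {a : Fin k → Fin n → ℝ} {b : Fin k → ℝ}
    (ha : ∀ i, a i ≠ 0) (hk : k ≤ m) {P : Set (Fin n → ℝ)}
    (hP : P = {x | ∀ i, a i ⬝ᵥ x ≤ b i}) (hint : (interior P).Nonempty)
    (hfree : ∀ z : Fin n → ℤ, (fun i => (z i : ℝ)) ∉ interior P) :
    P ∈ latticeFreePolyhedraLE n m := by
  have hconv : Convex ℝ P := hP ▸ convex_setOf_dotProduct_le a b
  have hspan := hconv.interior_nonempty_iff_affineSpan_eq_top.1 hint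
  refine ⟨⟨⟨⟨hconv, hP ▸ isClosed_setOf_dotProduct_le a b, hspan⟩, hfree⟩, k, a, b, hP⟩, ?_⟩
  exact (encard_facets_le ha hP hspan).trans (by exact_mod_cast hk)

/-- A horizontal split between consecutive integers belongs to the families. -/
lemma split_mem_latticeFreePolyhedraLE {d m : ℕ} (hm : 2 ≤ m) (t : ℤ) :
    {x : Fin (d + 1) → ℝ | (t : ℝ) ≤ x (Fin.last d) ∧ x (Fin.last d) ≤ t + 1} ∈
      latticeFreePolyhedraLE (d + 1) m := by
  have heq : {x : Fin (d + 1) → ℝ | (t : ℝ) ≤ x (Fin.last d) ∧ x (Fin.last d) ≤ t + 1} =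
      {x | ∀ i, (![Fin.snoc (0 : Fin d → ℝ) (-1), Fin.snoc (0 : Fin d → ℝ) 1] :
        Fin 2 → Fin (d + 1) → ℝ) i ⬝ᵥ x ≤ (![-(t : ℝ), t + 1] : Fin 2 → ℝ) i} := by
    ext x
    simp [Fin.forall_fin_two, snoc_dotProduct]
  refine mem_latticeFreePolyhedraLE_of_eq ?_ hm heq ?_ fun z hz => ?_
  · rw [Fin.forall_fin_two]
    exact ⟨snoc_ne_zero_right _ (by norm_num), snoc_ne_zero_right _ one_ne_zero⟩
  · refine ⟨fun _ => (t : ℝ) + 1 / 2, ?_⟩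
    rw [heq]
    refine mem_interior_of_forall_dotProduct_lt ?_
    rw [Fin.forall_fin_two]
    simp [snoc_dotProduct]
    norm_num
  · obtain ⟨h1, h2⟩ := last_mem_Ioo_of_mem_interior (fun x hx => hx) hz
    have h3 : t < z (Fin.last d) := by exact_mod_cast h1
    have h4 : z (Fin.last d) < t + 1 := by exact_mod_cast h2
    omega

/-- A polyhedron between the heights `t - 1` and `t + 1` whose section at height `t` is a
lattice-free polyhedron is lattice-free; tilting the inequalities of the section and adding one
bound on the height adds at most one facet. -/
lemma tilted_mem_latticeFreePolyhedraLE {d k m : ℕ} {a : Fin k → Fin d → ℝ} {b : Fin k → ℝ}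
    (ha : ∀ i, a i ≠ 0) (hk : k ≤ m)
    (hfree : ∀ z : Fin d → ℤ, (fun i => (z i : ℝ)) ∉ interior {x | ∀ i, a i ⬝ᵥ x ≤ b i})
    (t : ℤ) (e : Fin k → ℝ) {σ : ℝ} (hσ : σ ≠ 0) {B : Set (Fin (d + 1) → ℝ)}
    (hB : B = {x | (∀ i, a i ⬝ᵥ Fin.init x + e i * (x (Fin.last d) - t) ≤ b i) ∧
      σ * (x (Fin.last d) - t) ≤ 1})
    (hslab : ∀ x ∈ B, (t : ℝ) - 1 ≤ x (Fin.last d) ∧ x (Fin.last d) ≤ t + 1)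
    (hint : (interior B).Nonempty) :
    B ∈ latticeFreePolyhedraLE (d + 1) (m + 1) := by
  have heq : B = {x | ∀ i, (Fin.cons (Fin.snoc (0 : Fin d → ℝ) σ)
      (fun i => Fin.snoc (a i) (e i)) : Fin (k + 1) → Fin (d + 1) → ℝ) i ⬝ᵥ x ≤
      (Fin.cons (1 + σ * t) (fun i => b i + e i * t) : Fin (k + 1) → ℝ) i} := by
    rw [hB]
    ext x
    simp only [Set.mem_ofPred_eq, Fin.forall_fin_succ, Fin.cons_zero, Fin.cons_succ,
      snoc_dotProduct, zero_dotProduct, zero_add]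
    rw [and_comm]
    refine and_congr ?_ (forall_congr' fun i => ?_)
    · constructor <;> intro h <;> linarith
    · constructor <;> intro h <;> linarith
  refine mem_latticeFreePolyhedraLE_of_eq ?_ (Nat.succ_le_succ hk) heq hint fun z hz => ?_
  · rw [Fin.forall_fin_succ]
    exact ⟨snoc_ne_zero_right _ hσ, fun i => snoc_ne_zero_left (ha i) _⟩
  obtain ⟨h1, h2⟩ := last_mem_Ioo_of_mem_interior hslab hz
  have h3 : t - 1 < z (Fin.last d) := by exact_mod_cast h1
  have h4 : z (Fin.last d) < t + 1 := by exact_mod_cast h2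
  have hzt : z (Fin.last d) = t := by omega
  refine hfree (Fin.init z) ?_
  let J : (Fin d → ℝ) → Fin (d + 1) → ℝ := fun y => Fin.snoc y (t : ℝ)
  have hJ : Continuous J := by
    refine continuous_pi fun i => ?_
    refine Fin.lastCases ?_ (fun j => ?_) i
    · simpa [J] using continuous_const
    · simpa [J] using continuous_apply j
  refine interior_maximal ?_ (isOpen_interior.preimage hJ) (t := J ⁻¹' interior B) ?_
  · intro y hy i
    have := (hB.subset (interior_subset hy)).1 i
    simpa [J] using this
  · have : J (fun i => (Fin.init z i : ℝ)) = fun i => (z i : ℝ) := by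
      funext i
      refine Fin.lastCases ?_ (fun j => ?_) i
      · simp [J, hzt]
      · simp [J, Fin.init]
    rw [Set.mem_preimage, this]
    exact hz

/-- A polyhedron whose recession cone has interior points contains lattice points in its
interior. -/
lemma exists_int_forall_dotProduct_lt {d k : ℕ} {a : Fin k → Fin d → ℝ} (b : Fin k → ℝ)
    {p : Fin d → ℝ} (hp : ∀ i, 0 < a i ⬝ᵥ p) :
    ∃ z : Fin d → ℤ, ∀ i, a i ⬝ᵥ (fun j => (z j : ℝ)) < b i := by
  obtain ⟨N, hN⟩ : ∃ N : ℝ, ∀ i, (∑ j, |a i j| - b i) / (a i ⬝ᵥ p) < N := by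
    obtain ⟨N, hN⟩ := (Set.finite_range fun i => (∑ j, |a i j| - b i) / (a i ⬝ᵥ p)).bddAbove
    exact ⟨N + 1, fun i => (hN ⟨i, rfl⟩).trans_lt (lt_add_one N)⟩
  -- Rounding changes `a i ⬝ᵥ ·` by at most `∑ j, |a i j|`, which a large `N` absorbs.
  refine ⟨fun j => ⌊-(N * p j)⌋, fun i => ?_⟩
  have h1 := (div_lt_iff₀ (hp i)).1 (hN i)
  have h2 : a i ⬝ᵥ (fun j => ((⌊-(N * p j)⌋ : ℤ) : ℝ)) ≤ ∑ j, (|a i j| - N * (a i j * p j)) := by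
    refine Finset.sum_le_sum fun j _ => ?_
    have h3 := Int.floor_le (-(N * p j))
    have h4 := Int.lt_floor_add_one (-(N * p j))
    have h5 : a i j * ((⌊-(N * p j)⌋ : ℤ) + N * p j) ≤ |a i j| := by
      refine (le_abs_self _).trans ?_
      rw [abs_mul]
      refine mul_le_of_le_one_right (abs_nonneg _) ?_
      rw [abs_le]
      constructor <;> linarith
    linarith
  rw [Finset.sum_sub_distrib, ← Finset.mul_sum] at h2
  have h6 : ∑ j, a i j * p j = a i ⬝ᵥ p := rfl
  rw [h6] at h2
  linarith

/-- Such weights eliminate the first `d` coordinates from the tilted inequalities, leaving a bound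
on the height alone. -/
lemma sum_mul_dotProduct_eq_zero {d k : ℕ} {a : Fin k → Fin d → ℝ} {w : Fin k → ℝ}
    (hw : ∑ i, w i • a i = 0) (v : Fin d → ℝ) : ∑ i, w i * (a i ⬝ᵥ v) = 0 := by
  rw [← zero_dotProduct v, ← hw, sum_dotProduct]
  simp [smul_dotProduct]

/-- A set close to height `t` that satisfies tilted inequalities of a lattice-free polyhedron `D`
with some slack lies in a lattice-free polyhedron with at most one facet more than `D`. -/
lemma exists_superset_of_slack {d k m : ℕ} {a : Fin k → Fin d → ℝ} {b c : Fin k → ℝ}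
    (ha : ∀ i, a i ≠ 0) (hk : k ≤ m)
    (hfree : ∀ z : Fin d → ℤ, (fun i => (z i : ℝ)) ∉ interior {x | ∀ i, a i ⬝ᵥ x ≤ b i})
    (t : ℤ) {v : Fin d → ℝ} {s : ℝ} (hb : ∀ i, b i = 1 + a i ⬝ᵥ v + c i * s)
    (hs : |s| ≤ 1 / 3) {Z : Set (Fin (d + 1) → ℝ)} (hZ : (interior Z).Nonempty)
    (hheight : ∀ x ∈ Z, |x (Fin.last d) - t| ≤ 1 / 4)
    (hslack : ∀ x ∈ Z, ∀ i,
      a i ⬝ᵥ Fin.init x + c i * (x (Fin.last d) - t) ≤ b i - 3 / 4) :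
    ∃ B ∈ latticeFreePolyhedraLE (d + 1) (m + 1), Z ⊆ B := by
  obtain ⟨hs1, hs2⟩ := abs_le.1 hs
  have hcomb : ∀ (w : Fin k → ℝ), w ∈ stdSimplex ℝ (Fin k) → ∑ i, w i • a i = 0 →
      ∀ (e : Fin k → ℝ) (y : Fin d → ℝ) (h : ℝ), (∀ i, a i ⬝ᵥ y + e i * h ≤ b i) →
      (∑ i, w i * e i) * h ≤ 1 + (∑ i, w i * c i) * s := by
    intro w hw hwa e y h hle
    have h1 : ∑ i, w i * (a i ⬝ᵥ y + e i * h) ≤ ∑ i, w i * b i :=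
      Finset.sum_le_sum fun i _ => mul_le_mul_of_nonneg_left (hle i) (hw.1 i)
    have h2 : ∑ i, w i * (a i ⬝ᵥ y + e i * h) = (∑ i, w i * e i) * h := by
      simp only [mul_add, Finset.sum_add_distrib, sum_mul_dotProduct_eq_zero hwa, zero_add,
        Finset.sum_mul, mul_assoc]
    have h3 : ∑ i, w i * b i = 1 + (∑ i, w i * c i) * s := by
      simp only [hb, mul_add, Finset.sum_add_distrib, sum_mul_dotProduct_eq_zero hwa, add_zero,
        Finset.sum_mul, mul_assoc, mul_one, hw.2]
    rwa [h2, h3] at h1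
  rcases exists_dotProduct_gt_or_exists_stdSimplex a (fun i => c i - 3 / 2) with
    ⟨p, hp⟩ | ⟨w, hw, hwa, hwc⟩
  -- Weights annihilating the `a i` exist, since otherwise `D` would contain an interior lattice
  -- point.
  · rcases exists_dotProduct_gt_or_exists_stdSimplex a 0 with ⟨q, hq⟩ | ⟨w, hw, hwa, -⟩
    · obtain ⟨z, hz⟩ := exists_int_forall_dotProduct_lt b hq
      exact absurd (mem_interior_of_forall_dotProduct_lt hz) (hfree z)
    -- That is, `e i = min (c i) (a i ⬝ᵥ p - 3 / 2)`; the choice of `p` limits the decrease to 3.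
    set e : Fin k → ℝ := fun i => c i + min 0 (-(3 / 2) - (c i - a i ⬝ᵥ p)) with he
    have hec : ∀ i, e i ≤ c i := fun i => by
      have := min_le_left 0 (-(3 / 2) - (c i - a i ⬝ᵥ p))
      simp only [he]; linarith
    have hep : ∀ i, e i - a i ⬝ᵥ p ≤ -(3 / 2) := fun i => by
      have := min_le_right 0 (-(3 / 2) - (c i - a i ⬝ᵥ p))
      simp only [he]; linarith
    have hce : ∀ i, c i - 3 ≤ e i := fun i => by
      have : -3 ≤ min 0 (-(3 / 2) - (c i - a i ⬝ᵥ p)) :=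
        le_min (by norm_num) (by have : c i - 3 / 2 < a i ⬝ᵥ p := hp i; linarith)
      simp only [he]; linarith
    have havg : ∀ (g : Fin k → ℝ) (r : ℝ), (∀ i, g i - a i ⬝ᵥ p ≤ r) → ∑ i, w i * g i ≤ r := by
      intro g r hg
      have h1 : ∑ i, w i * (g i - a i ⬝ᵥ p) ≤ ∑ i, w i * r :=
        Finset.sum_le_sum fun i _ => mul_le_mul_of_nonneg_left (hg i) (hw.1 i)
      simp only [mul_sub, Finset.sum_sub_distrib, sum_mul_dotProduct_eq_zero hwa, sub_zero] at h1
      rwa [← Finset.sum_mul, hw.2, one_mul] at h1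
    have hu : ∑ i, w i * c i ≤ 3 / 2 := havg c _ fun i => by
      have : c i - 3 / 2 < a i ⬝ᵥ p := hp i; linarith
    have hu' : ∑ i, w i * e i ≤ -(3 / 2) := havg e _ hep
    have huu : ∑ i, w i * e i ≤ ∑ i, w i * c i :=
      Finset.sum_le_sum fun i _ => mul_le_mul_of_nonneg_left (hec i) (hw.1 i)
    set B : Set (Fin (d + 1) → ℝ) :=
      {x | (∀ i, a i ⬝ᵥ Fin.init x + e i * (x (Fin.last d) - t) ≤ b i) ∧
        1 * (x (Fin.last d) - t) ≤ 1} with hB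
    have hZB : Z ⊆ B := by
      intro x hx
      obtain ⟨h1, h2⟩ := abs_le.1 (hheight x hx)
      refine ⟨fun i => ?_, by linarith⟩
      have h3 := hslack x hx i
      have h4 := hec i
      -- The change `(e i - c i) * h` is at most `3 * (1/4)`, exactly the available slack.
      have h5 := hce i
      nlinarith
    refine ⟨B, tilted_mem_latticeFreePolyhedraLE ha hk hfree t e one_ne_zero hB ?_
      (hZ.mono (interior_mono hZB)), hZB⟩
    rintro x ⟨hx1, hx2⟩
    refine ⟨?_, by linarith⟩
    have h1 := hcomb w hw hwa e _ _ hx1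
    by_contra! hlt
    have h2 : -(∑ i, w i * e i) < (∑ i, w i * e i) * (x (Fin.last d) - t) := by
      nlinarith
    -- With `u = ∑ w c` and `u' = ∑ w e`, it suffices that `1 + u * s ≤ -u'`. For `u ≥ 0`, `u * s ≤
    -- 1/2`; for `u ≤ 0`, `u * s ≤ -u' / 3`; and `-u' ≥ 3/2`.
    rcases le_total 0 (∑ i, w i * c i) with h0 | h0 <;> nlinarith
  · have hu : 3 / 2 ≤ ∑ i, w i * c i := by
      have : ∑ i, w i * (c i - 3 / 2) = ∑ i, w i * c i - 3 / 2 := by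
        simp only [mul_sub, Finset.sum_sub_distrib]
        rw [← Finset.sum_mul, hw.2, one_mul]
      linarith
    set B : Set (Fin (d + 1) → ℝ) :=
      {x | (∀ i, a i ⬝ᵥ Fin.init x + c i * (x (Fin.last d) - t) ≤ b i) ∧
        (-1) * (x (Fin.last d) - t) ≤ 1} with hB
    have hZB : Z ⊆ B := by
      intro x hx
      obtain ⟨h1, h2⟩ := abs_le.1 (hheight x hx)
      exact ⟨fun i => by linarith [hslack x hx i], by linarith⟩
    refine ⟨B, tilted_mem_latticeFreePolyhedraLE ha hk hfree t c (by norm_num) hB ?_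
      (hZ.mono (interior_mono hZB)), hZB⟩
    rintro x ⟨hx1, hx2⟩
    refine ⟨by linarith, ?_⟩
    -- With `u = ∑ w c ≥ 3/2` this gives `h ≤ 1/u + s ≤ 2/3 + 1/3`.
    have h1 := hcomb w hw hwa c _ _ hx1
    by_contra! hlt
    nlinarith

/-! ### Homothetic copies, width and the theorem -/

lemma mem_interior_homothet {n : ℕ} {c : ℝ} (hc : c ≠ 0) {f : Fin n → ℝ}
    {L : Set (Fin n → ℝ)} (hf : f ∈ interior L) : f ∈ interior (homothet c f L) := by
  have hcont : Continuous fun x : Fin n → ℝ => c⁻¹ • (x - f) + f := by fun_prop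
  refine interior_maximal ?_ (isOpen_interior.preimage hcont) ?_
    (t := (fun x : Fin n → ℝ => c⁻¹ • (x - f) + f) ⁻¹' interior L)
  · intro x hx
    exact ⟨_, interior_subset hx, by simp [smul_smul, hc]⟩
  · simpa using hf

lemma sub_le_one_of_width_le_one {d : ℕ} {X : Set (Fin (d + 1) → ℝ)}
    (h : width X (lastBasisVector d) ≤ 1) {x y : Fin (d + 1) → ℝ} (hx : x ∈ X) (hy : y ∈ X) :
    x (Fin.last d) - y (Fin.last d) ≤ 1 := by
  have hdot : ∀ z : Fin (d + 1) → ℝ, z ⬝ᵥ lastBasisVector d = z (Fin.last d) := fun z => by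
    simp [lastBasisVector]
  have h1 : ((x (Fin.last d) : ℝ) : EReal) - ((y (Fin.last d) : ℝ) : EReal) ≤ 1 := by
    refine le_trans (EReal.sub_le_sub ?_ ?_) h
    · rw [← hdot x]
      exact le_iSup₂ (f := fun z (_ : z ∈ X) => ((z ⬝ᵥ lastBasisVector d : ℝ) : EReal)) x hx
    · rw [← hdot y]
      exact iInf₂_le (f := fun z (_ : z ∈ X) => ((z ⬝ᵥ lastBasisVector d : ℝ) : EReal)) y hy
  exact_mod_cast h1

end LatticeFree

open scoped Matrix in
theorem lemma5p3 (d : ℕ) (L : Set (Fin (d + 1) → ℝ))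
    (hL : L ∈ LatticeFree.latticeFreePolyhedra (d + 1))
    (f : Fin (d + 1) → ℝ) (hf : f ∈ interior L)
    (γ : ℝ) (hγ : γ ∈ Set.Ioc (0 : ℝ) 1)
    (m : ℕ) (hm : 0 < m) (t : ℤ)
    (D : Set (Fin d → ℝ)) (hDmax : LatticeFree.IsMaximalLatticeFree d D)
    (hDm : D ∈ LatticeFree.latticeFreePolyhedraLE d m)
    (ha : L ∩ LatticeFree.atHeight Set.univ (t : ℝ) ⊆ LatticeFree.atHeight D (t : ℝ))
    (hb : LatticeFree.width (LatticeFree.homothet γ f L) (LatticeFree.lastBasisVector d) ≤ 1)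
    (hc : (LatticeFree.homothet γ f L ∩
      LatticeFree.atHeight Set.univ (t : ℝ)).Nonempty) :
    ∃ B ∈ LatticeFree.latticeFreePolyhedraLE (d + 1) (m + 1),
      LatticeFree.homothet (1 / 4 * γ) f L ⊆ B := by
  open LatticeFree in
  have hγ0 : 0 < γ := hγ.1
  have hγ1 : γ ≤ 1 := hγ.2
  have hLconv : Convex ℝ L := hL.1.body.convex
  have hfL : f ∈ L := interior_subset hf
  set s : ℝ := f (Fin.last d) - t with hs
  -- `η x` is the height above `t` of the image of `x` in `L'`.
  set η : (Fin (d + 1) → ℝ) → ℝ := fun x => γ * (x (Fin.last d) - f (Fin.last d)) + s with hη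
  have hη_mem : ∀ x ∈ L, ∀ y ∈ L, η x - η y ≤ 1 := by
    intro x hx y hy
    have := sub_le_one_of_width_le_one hb ⟨x, hx, rfl⟩ ⟨y, hy, rfl⟩
    simp only [Pi.add_apply, Pi.smul_apply, Pi.sub_apply, smul_eq_mul] at this
    simp only [hη]
    linarith
  have hηf : η f = s := by simp [hη]
  obtain ⟨x₀, hx₀, hx₀t⟩ : ∃ x ∈ L, η x = 0 := by
    obtain ⟨_, ⟨x, hx, rfl⟩, -, hxt⟩ := hc
    refine ⟨x, hx, ?_⟩
    simp only [Pi.add_apply, Pi.smul_apply, Pi.sub_apply, smul_eq_mul] at hxt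
    simp only [hη, hs]
    linarith
  have hlast : ∀ x, ((1 / 4 * γ) • (x - f) + f) (Fin.last d) = t + (3 * s + η x) / 4 := by
    intro x
    simp only [Pi.add_apply, Pi.smul_apply, Pi.sub_apply, smul_eq_mul, hη, hs]
    ring
  have hs1 := hη_mem f hfL x₀ hx₀
  have hs2 := hη_mem x₀ hx₀ f hfL
  by_cases hup : ∀ x ∈ L, 0 ≤ 3 * s + η x
  · refine ⟨_, split_mem_latticeFreePolyhedraLE (by omega) t, ?_⟩
    rintro _ ⟨x, hx, rfl⟩
    simp only [Set.mem_ofPred_eq, hlast]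
    have h1 := hup x hx
    have h2 := hη_mem x hx x₀ hx₀
    constructor <;> linarith
  by_cases hdown : ∀ x ∈ L, 3 * s + η x ≤ 0
  · refine ⟨_, split_mem_latticeFreePolyhedraLE (by omega) (t - 1), ?_⟩
    rintro _ ⟨x, hx, rfl⟩
    simp only [Set.mem_ofPred_eq, hlast]
    push_cast
    have h1 := hdown x hx
    have h2 := hη_mem x₀ hx₀ x hx
    constructor <;> linarith
  push Not at hup hdown
  obtain ⟨y, hy, hys⟩ := hup
  obtain ⟨x, hx, hxs⟩ := hdown
  have hxx₀ := hη_mem x hx x₀ hx₀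
  have hyx₀ := hη_mem x₀ hx₀ y hy
  -- Since `|η| ≤ 1` on `L`, the two signs of `3 * s + η` force this.
  have hs3 : |s| ≤ 1 / 3 := abs_le.2 ⟨by linarith, by linarith⟩
  have hsub : ∀ z ∈ L, (1 / 4 * γ) • (z - f) + f ∈ L := by
    intro z hz
    have := hLconv hz hfL (a := 1 / 4 * γ) (b := 1 - 1 / 4 * γ) (by positivity) (by linarith)
      (by ring)
    convert this using 1
    module
  obtain ⟨k, a, b, hkm, ha0, hD⟩ := IsPolyhedron.exists_of_encard_facets_le hDm.1.2
    hDm.1.1.body.full_dim hDm.2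
  have htilt : ∀ i, ∃ c : ℝ, ∀ z ∈ L,
      a i ⬝ᵥ Fin.init z + c * (z (Fin.last d) - t) ≤ b i := by
    intro i
    have hg : ∀ z : Fin (d + 1) → ℝ,
        dotCLM (Fin.snoc (a i) 0 : Fin (d + 1) → ℝ) z = a i ⬝ᵥ Fin.init z := fun z => by
      simp [snoc_dotProduct]
    have hh : ∀ z : Fin (d + 1) → ℝ,
        dotCLM (Fin.snoc (0 : Fin d → ℝ) 1 : Fin (d + 1) → ℝ) z = z (Fin.last d) := fun z => by
      simp [snoc_dotProduct]
    obtain ⟨c, hc⟩ := exists_tilted_inequality (b := b i) (t := t) hLconv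
      (dotCLM (Fin.snoc (a i) 0 : Fin (d + 1) → ℝ)).toLinearMap
      (dotCLM (Fin.snoc (0 : Fin d → ℝ) 1 : Fin (d + 1) → ℝ)).toLinearMap
      (fun z hz hzt => by
        rw [ContinuousLinearMap.coe_coe, hh] at hzt
        rw [ContinuousLinearMap.coe_coe, hg]
        exact (hD.subset (ha ⟨hz, trivial, hzt⟩).1) i)
      -- The quarter copies of `x` and `y` are points of `L` strictly above and below height `t`.
      ⟨_, hsub x hx, by rw [ContinuousLinearMap.coe_coe, hh, hlast]; linarith⟩
      ⟨_, hsub y hy, by rw [ContinuousLinearMap.coe_coe, hh, hlast]; linarith⟩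
    refine ⟨c, fun z hz => ?_⟩
    have := hc z hz
    rwa [ContinuousLinearMap.coe_coe, hg, ContinuousLinearMap.coe_coe, hh] at this
  choose c hcL using htilt
  -- `β i` is the slack at `f`; dividing by it normalises the slack to 1.
  set β : Fin k → ℝ := fun i => b i - a i ⬝ᵥ Fin.init f - c i * s with hβ
  have hβ0 : ∀ i, 0 < β i := by
    intro i
    have := dotProduct_lt_of_mem_interior (a := Fin.snoc (a i) (c i)) (b := b i + c i * t)
      (snoc_ne_zero_left (ha0 i) _)
      (fun z hz => by rw [snoc_dotProduct]; linarith [hcL i z hz]) hf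
    rw [snoc_dotProduct] at this
    simp only [hβ, hs]
    linarith
  have hDβ : {z : Fin d → ℝ | ∀ i, ((β i)⁻¹ • a i) ⬝ᵥ z ≤ (β i)⁻¹ * b i} = D := by
    rw [hD]
    ext z
    refine forall_congr' fun i => ?_
    rw [smul_dotProduct, smul_eq_mul, mul_le_mul_iff_right₀ (inv_pos.2 (hβ0 i))]
  refine exists_superset_of_slack (a := fun i => (β i)⁻¹ • a i) (b := fun i => (β i)⁻¹ * b i)
    (c := fun i => (β i)⁻¹ * c i) (v := Fin.init f) (s := s)
    (fun i => smul_ne_zero (inv_pos.2 (hβ0 i)).ne' (ha0 i)) hkm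
    (by rw [hDβ]; exact hDm.1.1.free) t (fun i => ?_) hs3
    ⟨f, mem_interior_homothet (by positivity) hf⟩ ?_ ?_
  · have : b i = β i + a i ⬝ᵥ Fin.init f + c i * s := by simp only [hβ]; ring
    rw [this, mul_add, mul_add, inv_mul_cancel₀ (hβ0 i).ne', smul_dotProduct, smul_eq_mul,
      mul_assoc]
  · rintro _ ⟨z, hz, rfl⟩
    have h1 := hη_mem z hz y hy
    have h2 := hη_mem x hx z hz
    beta_reduce
    rw [hlast, abs_le]
    constructor <;> linarith
  · rintro _ ⟨z, hz, rfl⟩ i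
    have h1 := hcL i z hz
    have h2 : Fin.init ((1 / 4 * γ) • (z - f) + f) =
        (1 / 4 * γ) • (Fin.init z - Fin.init f) + Fin.init f := rfl
    have h3 : a i ⬝ᵥ Fin.init ((1 / 4 * γ) • (z - f) + f) +
        c i * (((1 / 4 * γ) • (z - f) + f) (Fin.last d) - t) ≤ b i - 3 / 4 * β i := by
      rw [h2, dotProduct_add, dotProduct_smul, dotProduct_sub]
      simp only [Pi.add_apply, Pi.smul_apply, Pi.sub_apply, smul_eq_mul]
      have h4 : a i ⬝ᵥ Fin.init z - a i ⬝ᵥ Fin.init f +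
          c i * (z (Fin.last d) - f (Fin.last d)) ≤ β i := by
        simp only [hβ, hs]; linarith
      have h5 := mul_le_mul_of_nonneg_left h4 (by positivity : 0 ≤ 1 / 4 * γ)
      -- A homothety of ratio at most `1/4` centred at `f` uses up at most a quarter of the slack at
      -- `f`.
      have h6 : 1 / 4 * γ * β i ≤ 1 / 4 * β i := by nlinarith [hβ0 i]
      have h7 : b i = β i + a i ⬝ᵥ Fin.init f + c i * (f (Fin.last d) - t) := by
        simp only [hβ, hs]; ring
      linarith
    have h8 := mul_le_mul_of_nonneg_left h3 (inv_pos.2 (hβ0 i)).le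
    rw [smul_dotProduct, smul_eq_mul, mul_assoc, ← mul_add]
    refine h8.trans (le_of_eq ?_)
    have := (hβ0 i).ne'
    field_simp
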